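/- Let $X$ be a compact Hausdorff space, let $C(X)$ be the Banach lattice of continuous real-valued functions on $X$, let $F$ be a (real) Banach lattice, and let $T\colon C(X)\to F$ be a disjointness preserving operator, i.e. a linear map (not assumed continuous) such that $|f|\wedge|g|=0$ implies $|Tf|\wedge|Tg|=0$. For open $U\subseteq X$ put $K_U=\{f\in C(X): f=0 \text{ on } X\setminus U\}$, and for $x\in X$ put $M_x=\{f\in C(X): f(x)=0\}$ and $J_x=\{f\in C(X): f=0 \text{ on some open neighborhood of } x\}$. Let the singularity set $\mathcal F_T$ be the set of all $x\in X$ such that for every open neighborhood $U$ of $x$ the restriction $T|_{K_U}\colon K_U\to F$ is discontinuous. Then: 1. $\mathcal F_T=\emptyset$ if and only if $T$ is continuous. 2. $\mathcal F_T$ is finite. 3. If $\mathcal F_T=\{x_1,\dots,x_n\}$ with $x_1,\dots,x_n$ distinct, then there exist a continuous disjointness preserving operator $R\colon C(X)\to F$ and disjointness preserving operators $S_1,\dots,S_n\colon C(X)\to F$ such that $T=R+S_1+\dots+S_n$ and, for each $1\le i\le n$, $S_i|_{M_{x_i}}\neq 0$ and $S_i|_{J_{x_i}}=0$. -/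

import Mathlib

open Topology

/-- A linear operator between vector lattices is disjointness preserving if it sends disjoint
elements (`|f| ⊓ |g| = 0`) to disjoint elements. No continuity is assumed. -/
def IsDisjointnessPreserving {E F : Type*} [AddCommGroup E] [Lattice E] [Module ℝ E]
    [AddCommGroup F] [Lattice F] [Module ℝ F] (T : E →ₗ[ℝ] F) : Prop :=
  ∀ f g : E, |f| ⊓ |g| = 0 → |T f| ⊓ |T g| = 0

section Ideals

variable {X : Type*} [TopologicalSpace X]

/-- `K_U`: the ideal of all continuous functions vanishing off `U`. -/
def idealK (U : Set X) : Ideal C(X, ℝ) where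
  carrier := {f | ∀ x ∈ Uᶜ, f x = 0}
  zero_mem' := fun _ _ => rfl
  add_mem' := fun {f g} hf hg x hx => by simp [hf x hx, hg x hx]
  smul_mem' := fun c f hf x hx => by simp [hf x hx]

/-- `M_x`: the maximal ideal of all continuous functions vanishing at `x`. -/
def idealM (x : X) : Ideal C(X, ℝ) where
  carrier := {f | f x = 0}
  zero_mem' := rfl
  add_mem' := fun {f g} hf hg => by
    have h1 : f x = 0 := hf
    have h2 : g x = 0 := hg
    simp [h1, h2]
  smul_mem' := fun c f hf => by
    have h1 : f x = 0 := hf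
    simp [h1]

/-- `J_x`: the ideal of all continuous functions vanishing on some open neighborhood of `x`. -/
def idealJ (x : X) : Ideal C(X, ℝ) where
  carrier := {f | ∃ U : Set X, IsOpen U ∧ x ∈ U ∧ ∀ y ∈ U, f y = 0}
  zero_mem' := ⟨Set.univ, isOpen_univ, trivial, fun _ _ => rfl⟩
  add_mem' := by
    rintro f g ⟨U, hU, hxU, hf⟩ ⟨V, hV, hxV, hg⟩
    exact ⟨U ∩ V, hU.inter hV, ⟨hxU, hxV⟩, fun y hy => by simp [hf y hy.1, hg y hy.2]⟩
  smul_mem' := by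
    rintro c f ⟨U, hU, hxU, hf⟩
    exact ⟨U, hU, hxU, fun y hy => by simp [hf y hy]⟩

/-- The singularity set of `T`: the points `x` such that, for every open neighborhood `U` of `x`,
the restriction of `T` to `K_U` is discontinuous. -/
def singularitySet {F : Type*} [AddCommGroup F] [Module ℝ F] [TopologicalSpace F]
    (T : C(X, ℝ) →ₗ[ℝ] F) : Set X :=
  {x | ∀ U : Set X, IsOpen U → x ∈ U → ¬ Continuous (fun f : idealK U => T (f : C(X, ℝ)))}

end Ideals

/-! ### Disjoint elements in lattice-ordered groups -/

section LatticeOrderedGroup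

variable {F : Type*} [AddCommGroup F] [Lattice F] [IsOrderedAddMonoid F]

/-! Summing a disjoint sequence with weights `2⁻ⁿ` shows that `T` cannot grow like `4ⁿ` along it.
This gliding hump (`exists_bound_of_filter`) rules out an accumulation point of singularities and
bounds `T` on functions vanishing near all of them. Finitely many coefficients extend the bound to
functions constant near each singularity. These are dense, so `T` on them extends to a continuous
`R`. The approximants vanish wherever the given function does, so disjointness survives the limit
for both `R` and `T - R`. As `T - R` kills functions vanishing near all singularities, cutting it
off by bumps `e (x i)` gives the `S i`. If `S i` killed `idealM (x i)`, `T` would be bounded near `x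
i`. -/

theorem inf_add_le_inf_add_inf {a b c : F} (ha : 0 ≤ a) (hb : 0 ≤ b) (hc : 0 ≤ c) :
    a ⊓ (b + c) ≤ a ⊓ b + a ⊓ c := by
  have h : a ⊓ (b + c) - a ⊓ b ≤ a ⊓ c := by
    refine le_inf ?_ ?_
    · rw [sub_le_iff_le_add]
      exact inf_le_left.trans (le_add_of_nonneg_right (le_inf ha hb))
    · rw [sub_le_iff_le_add, add_inf]
      exact le_inf (inf_le_left.trans (le_add_of_nonneg_left hc))
        (inf_le_right.trans (add_comm b c).le)
  rwa [sub_le_iff_le_add'] at h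

theorem abs_le_abs_add_of_abs_inf_abs_eq_zero {a b : F} (h : |a| ⊓ |b| = 0) :
    |a| ≤ |a + b| := by
  have h1 : |a| ≤ |a + b| + |b| := by
    calc |a| = |(a + b) + (-b)| := by rw [add_neg_cancel_right]
      _ ≤ |a + b| + |-b| := abs_add_le _ _
      _ = |a + b| + |b| := by rw [abs_neg]
  calc |a| = |a| ⊓ (|a + b| + |b|) := (inf_eq_left.2 h1).symm
    _ ≤ |a| ⊓ |a + b| + |a| ⊓ |b| :=
      inf_add_le_inf_add_inf (abs_nonneg _) (abs_nonneg _) (abs_nonneg _)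
    _ = |a| ⊓ |a + b| := by rw [h, add_zero]
    _ ≤ |a + b| := inf_le_right

end LatticeOrderedGroup

/-! ### Bump functions and approximation in `C(X, ℝ)` -/

section ContinuousFunctions

variable {X : Type*} [TopologicalSpace X]

theorem ContinuousMap.abs_inf_abs_eq_zero_iff {f g : C(X, ℝ)} :
    |f| ⊓ |g| = 0 ↔ ∀ x, f x = 0 ∨ g x = 0 := by
  rw [ContinuousMap.ext_iff]
  refine forall_congr' fun x => ?_
  rw [ContinuousMap.inf_apply, ContinuousMap.abs_apply, ContinuousMap.abs_apply,
    ContinuousMap.zero_apply]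
  constructor
  · intro h
    rcases min_choice |f x| |g x| with h' | h'
    · exact Or.inl (abs_eq_zero.1 (h'.symm.trans h))
    · exact Or.inr (abs_eq_zero.1 (h'.symm.trans h))
  · rintro (h | h)
    · simp [h]
    · simp [h]

theorem eventuallyEq_zero_of_notMem_tsupport {u : C(X, ℝ)} {x : X} (hx : x ∉ tsupport u) :
    ∀ᶠ y in 𝓝 x, u y = 0 :=
  notMem_tsupport_iff_eventuallyEq.1 hx

variable [CompactSpace X] [T2Space X]

theorem exists_bump_nhdsSet {K V : Set X} (hK : IsClosed K) (hV : IsOpen V) (hKV : K ⊆ V) :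
    ∃ u : C(X, ℝ), (∀ᶠ y in 𝓝ˢ K, u y = 1) ∧ (∀ y, |u y| ≤ 1) ∧ tsupport u ⊆ V := by
  obtain ⟨W, hW, hKW, hWV⟩ := normal_exists_closure_subset hK hV hKV
  obtain ⟨u, hu, hu1, hu2⟩ := exists_tsupport_one_of_isOpen_isClosed hV
    isClosed_closure.isCompact isClosed_closure hWV
  refine ⟨u, ?_, fun y => abs_le.2 ⟨by linarith [(hu2 y).1], (hu2 y).2⟩, hu⟩
  exact Filter.mem_of_superset (hW.mem_nhdsSet.2 hKW) fun y hy => hu1 (subset_closure hy)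

/-- Every continuous function is uniformly approximated by functions that are constant near each
point of a finite set and vanish wherever the given function does. -/
theorem exists_approx_locallyConst (P : Finset X) (f : C(X, ℝ)) {ε : ℝ} (hε : 0 < ε) :
    ∃ g : C(X, ℝ), ‖f - g‖ ≤ ε ∧ (∀ y, f y = 0 → g y = 0) ∧
      ∀ x ∈ P, ∀ᶠ y in 𝓝 x, g y = g x := by
  classical
  induction P using Finset.induction_on generalizing ε with
  | empty => exact ⟨f, by simp [hε.le], fun y h => h, by simp⟩
  | insert x P hx ih =>
    obtain ⟨g, hg1, hg2, hg3⟩ := ih (half_pos hε)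
    -- Flattening `g` to `g x` inside this set costs at most `ε / 2`, creates no value off the zero
    -- set of `f`, and leaves `g` alone near the points already treated.
    have hV : IsOpen ({y | |g x - g y| < ε / 2} ∩ {y | g x ≠ 0 → g y ≠ 0} ∩ (P : Set X)ᶜ) := by
      refine ((isOpen_lt (by fun_prop) continuous_const).inter ?_).inter
        P.finite_toSet.isClosed.isOpen_compl
      by_cases h : g x = 0
      · simp [h]
      · simpa [h] using isOpen_ne_fun g.continuous continuous_const
    obtain ⟨u, hu1, hu2, hu3⟩ := exists_bump_nhdsSet (isClosed_singleton (x := x)) hV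
      (by simpa [hx] using hε)
    rw [nhdsSet_singleton] at hu1
    have hu4 : ∀ y, u y ≠ 0 → y ∈ ({y | |g x - g y| < ε / 2} ∩ {y | g x ≠ 0 → g y ≠ 0} ∩
        (P : Set X)ᶜ) := fun y hy => hu3 (subset_tsupport _ hy)
    refine ⟨g + u * (ContinuousMap.const X (g x) - g), ?_, ?_, ?_⟩
    · have h : ‖u * (ContinuousMap.const X (g x) - g)‖ ≤ ε / 2 := by
        refine (ContinuousMap.norm_le _ (half_pos hε).le).2 fun y => ?_
        by_cases hy : u y = 0
        · simpa [hy] using (half_pos hε).le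
        · have h1 : |g x - g y| < ε / 2 := (hu4 y hy).1.1
          rw [ContinuousMap.mul_apply, norm_mul]
          calc ‖u y‖ * |g x - g y| ≤ 1 * (ε / 2) := by
                gcongr
                exact hu2 y
            _ = ε / 2 := one_mul _
      calc ‖f - (g + u * (ContinuousMap.const X (g x) - g))‖
          = ‖(f - g) - u * (ContinuousMap.const X (g x) - g)‖ := by rw [sub_add_eq_sub_sub]
        _ ≤ ε / 2 + ε / 2 := (norm_sub_le _ _).trans (add_le_add hg1 h)
        _ = ε := add_halves ε
    · intro y hy
      have h0 := hg2 y hy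
      by_cases hc : g x = 0
      · simp [h0, hc]
      · have : u y = 0 := by
          by_contra h
          exact (hu4 y h).1.2 hc h0
        simp [h0, this]
    · intro p hp
      rcases Finset.mem_insert.1 hp with rfl | hp
      · filter_upwards [hu1] with y hy
        simp [hy]
      · have hpu : p ∉ tsupport u := fun h => (hu3 h).2 hp
        have hup := eventuallyEq_zero_of_notMem_tsupport hpu
        filter_upwards [hup, hg3 p hp] with y hy1 hy2
        simp [hy1, hup.self_of_nhds, hy2]

/-- For a finite set of points there are functions that are `1` near one of the points and `0` near
all the others. -/
theorem exists_dual_bumps (P : Finset X) :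
    ∃ e : X → C(X, ℝ), (∀ x, ∀ᶠ y in 𝓝 x, e x y = 1) ∧
      ∀ x, ∀ p ∈ P, p ≠ x → ∀ᶠ y in 𝓝 p, e x y = 0 := by
  have h : ∀ x : X, ∃ u : C(X, ℝ), (∀ᶠ y in 𝓝 x, u y = 1) ∧
      ∀ p ∈ P, p ≠ x → ∀ᶠ y in 𝓝 p, u y = 0 := by
    intro x
    obtain ⟨u, hu1, -, hu3⟩ := exists_bump_nhdsSet (isClosed_singleton (x := x))
      ((P.finite_toSet.subset Set.sdiff_subset).isClosed.isOpen_compl :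
        IsOpen ((P : Set X) \ {x})ᶜ) (by simp)
    rw [nhdsSet_singleton] at hu1
    exact ⟨u, hu1, fun p hp hpx => eventuallyEq_zero_of_notMem_tsupport fun h =>
      hu3 h ⟨hp, hpx⟩⟩
  choose e he using h
  exact ⟨e, fun x => (he x).1, fun x => (he x).2⟩

end ContinuousFunctions

/-! ### Bounds away from and near the singularities -/

section Operators

variable {X : Type*} [TopologicalSpace X] [CompactSpace X]
  {F : Type*} [NormedAddCommGroup F] [NormedSpace ℝ F]

theorem LinearMap.continuous_restrict_iff {E : Type*} [NormedAddCommGroup E] [NormedSpace ℝ E]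
    (T : E →ₗ[ℝ] F) (A : Submodule ℝ E) :
    Continuous (fun f : A => T f) ↔ ∃ C, ∀ f ∈ A, ‖T f‖ ≤ C * ‖f‖ := by
  constructor
  · intro h
    let L : A →L[ℝ] F := ⟨T ∘ₗ A.subtype, h⟩
    exact ⟨‖L‖, fun f hf => L.le_opNorm ⟨f, hf⟩⟩
  · rintro ⟨C, hC⟩
    exact ((T ∘ₗ A.subtype).mkContinuous C fun f => hC f f.2).continuous

theorem continuous_restrict_idealK_iff (T : C(X, ℝ) →ₗ[ℝ] F) (U : Set X) :
    Continuous (fun f : idealK U => T (f : C(X, ℝ))) ↔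
      ∃ C, ∀ f : C(X, ℝ), (∀ x ∉ U, f x = 0) → ‖T f‖ ≤ C * ‖f‖ :=
  T.continuous_restrict_iff ((idealK U).restrictScalars ℝ)

theorem exists_norm_le_one_lt_of_forall_not_bound (T : C(X, ℝ) →ₗ[ℝ] F)
    (A : Submodule ℝ C(X, ℝ)) (h : ¬ ∃ C, ∀ f ∈ A, ‖T f‖ ≤ C * ‖f‖) (M : ℝ) :
    ∃ f ∈ A, ‖f‖ ≤ 1 ∧ M < ‖T f‖ := by
  by_contra! hM
  refine h ⟨M, fun f hf => ?_⟩
  by_cases h0 : f = 0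
  · simp [h0]
  have hpos : 0 < ‖f‖ := norm_pos_iff.2 h0
  have h1 := hM (‖f‖⁻¹ • f) (A.smul_mem _ hf) (by
    rw [norm_smul, norm_inv, norm_norm, inv_mul_cancel₀ hpos.ne'])
  rw [map_smul, norm_smul, norm_inv, norm_norm, inv_mul_le_iff₀ hpos] at h1
  linarith

/-- If no point of a closed set is singular, then the operator is bounded on the functions vanishing
off that set. -/
theorem exists_bound_of_disjoint_singularitySet [T2Space X] (T : C(X, ℝ) →ₗ[ℝ] F) {K : Set X}
    (hK : IsClosed K) (h : ∀ x ∈ K, x ∉ singularitySet T) :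
    ∃ C, ∀ f : C(X, ℝ), (∀ x ∉ K, f x = 0) → ‖T f‖ ≤ C * ‖f‖ := by
  have h' : ∀ x : K, ∃ U : Set X, IsOpen U ∧ (x : X) ∈ U ∧
      ∃ C, ∀ f : C(X, ℝ), (∀ x ∉ U, f x = 0) → ‖T f‖ ≤ C * ‖f‖ := by
    intro x
    have hx := h x x.2
    simp only [singularitySet, Set.mem_ofPred_eq] at hx
    push Not at hx
    obtain ⟨U, hU, hxU, hc⟩ := hx
    exact ⟨U, hU, hxU, (continuous_restrict_idealK_iff T U).1 hc⟩
  choose U hU hxU C hC using h'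
  obtain ⟨t, ht⟩ := hK.isCompact.elim_finite_subcover U hU
    fun x hx => Set.mem_iUnion.2 ⟨⟨x, hx⟩, hxU ⟨x, hx⟩⟩
  let c : Fin t.card → K := fun i => (t.equivFin.symm i : K)
  have hcov : K ⊆ ⋃ i, U (c i) := by
    intro x hx
    obtain ⟨y, hy, hxy⟩ := Set.mem_iUnion₂.1 (ht hx)
    exact Set.mem_iUnion.2 ⟨t.equivFin ⟨y, hy⟩, by simpa [c] using hxy⟩
  obtain ⟨u, hu1, hu2, hu3, -⟩ := exists_continuous_sum_one_of_isOpen_isCompact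
    (fun i => hU (c i)) hK.isCompact hcov
  refine ⟨∑ i, |C (c i)|, fun f hf => ?_⟩
  have hsum : f = ∑ i, u i * f := by
    ext x
    rw [← Finset.sum_mul, ContinuousMap.mul_apply]
    by_cases hx : x ∈ K
    · have h1 : (∑ i, u i) x = 1 := by
        rw [ContinuousMap.sum_apply, ← Finset.sum_apply]
        exact hu2 hx
      rw [h1, one_mul]
    · simp [hf x hx]
  have hle : ∀ i, ‖T (u i * f)‖ ≤ |C (c i)| * ‖f‖ := by
    intro i
    have h1 : ‖u i * f‖ ≤ ‖f‖ := by
      refine (ContinuousMap.norm_le _ (norm_nonneg _)).2 fun x => ?_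
      rw [ContinuousMap.mul_apply, norm_mul, Real.norm_of_nonneg (hu3 i x).1]
      calc u i x * ‖f x‖ ≤ 1 * ‖f‖ :=
            mul_le_mul (hu3 i x).2 (f.norm_coe_le_norm x) (norm_nonneg _) zero_le_one
        _ = ‖f‖ := one_mul _
    have h2 : ∀ x ∉ U (c i), (u i * f) x = 0 := fun x hx => by
      rw [ContinuousMap.mul_apply, image_eq_zero_of_notMem_tsupport fun h => hx (hu1 i h),
        zero_mul]
    calc ‖T (u i * f)‖ ≤ C (c i) * ‖u i * f‖ := hC _ _ h2
      _ ≤ |C (c i)| * ‖f‖ := by gcongr; exact le_abs_self _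
  calc ‖T f‖ = ‖∑ i, T (u i * f)‖ := by rw [← map_sum, ← hsum]
    _ ≤ ∑ i, |C (c i)| * ‖f‖ := norm_sum_le_of_le _ fun i _ => hle i
    _ = (∑ i, |C (c i)|) * ‖f‖ := (Finset.sum_mul _ _ _).symm

theorem singularitySet_eq_empty_iff [T2Space X] (T : C(X, ℝ) →ₗ[ℝ] F) :
    singularitySet T = ∅ ↔ Continuous T := by
  constructor
  · intro h
    obtain ⟨C, hC⟩ := exists_bound_of_disjoint_singularitySet T isClosed_univ (by simp [h])
    exact (T.mkContinuous C fun f => hC f (by simp)).continuous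
  · intro h
    refine Set.eq_empty_of_forall_notMem fun x hx => ?_
    exact hx Set.univ isOpen_univ trivial (h.comp continuous_subtype_val)

section Lattice

variable [Lattice F] [IsOrderedAddMonoid F] [HasSolidNorm F]

-- `T f` and `T g` are disjoint, so adding `T g` cannot shrink `|T f|`.
omit [CompactSpace X] in
theorem IsDisjointnessPreserving.norm_le_norm_add {T : C(X, ℝ) →ₗ[ℝ] F}
    (hT : IsDisjointnessPreserving T) {f g : C(X, ℝ)} (h : ∀ x, f x = 0 ∨ g x = 0) :
    ‖T f‖ ≤ ‖T (f + g)‖ := by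
  rw [map_add]
  exact norm_le_norm_of_abs_le_abs (abs_le_abs_add_of_abs_inf_abs_eq_zero
    (hT f g (ContinuousMap.abs_inf_abs_eq_zero_iff.2 h)))

/-- Each term of `∑ 2⁻ⁿ f n` is disjoint from the rest, so its image is dominated by the image of
the whole sum. -/
theorem IsDisjointnessPreserving.exists_norm_le_two_pow {T : C(X, ℝ) →ₗ[ℝ] F}
    (hT : IsDisjointnessPreserving T) {f : ℕ → C(X, ℝ)} (hf : ∀ n, ‖f n‖ ≤ 1)
    (hd : ∀ m n, m ≠ n → ∀ x, f m x = 0 ∨ f n x = 0) :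
    ∃ C, ∀ n, ‖T (f n)‖ ≤ 2 ^ n * C := by
  have hs : Summable fun n => (1 / 2 : ℝ) ^ n • f n := by
    refine Summable.of_norm_bounded summable_geometric_two fun n => ?_
    rw [norm_smul, norm_pow, Real.norm_of_nonneg (by norm_num)]
    exact mul_le_of_le_one_right (by positivity) (hf n)
  refine ⟨‖T (∑' n, (1 / 2 : ℝ) ^ n • f n)‖, fun n => ?_⟩
  have h : ‖T ((1 / 2 : ℝ) ^ n • f n)‖ ≤
      ‖T ((1 / 2 : ℝ) ^ n • f n + ((∑' n, (1 / 2 : ℝ) ^ n • f n) - (1 / 2 : ℝ) ^ n • f n))‖ := by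
    refine hT.norm_le_norm_add fun x => ?_
    by_cases hx : f n x = 0
    · left
      simp [hx]
    · right
      rw [ContinuousMap.sub_apply, ← ContinuousMap.tsum_apply hs, tsum_eq_single n, sub_self]
      intro m hm
      simp [(hd m n hm x).resolve_right hx]
  rw [add_sub_cancel, map_smul, norm_smul, norm_pow, Real.norm_of_nonneg (by norm_num)] at h
  calc ‖T (f n)‖ = 2 ^ n * ((1 / 2) ^ n * ‖T (f n)‖) := by
        rw [← mul_assoc, ← mul_pow]
        norm_num
    _ ≤ _ := by gcongr

/-- Gliding hump: a disjointness preserving operator cannot be unbounded on the functions that live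
in arbitrarily small members of a filter, but vanish on some member of it. -/
theorem IsDisjointnessPreserving.exists_bound_of_filter {T : C(X, ℝ) →ₗ[ℝ] F}
    (hT : IsDisjointnessPreserving T) (l : Filter X) :
    ∃ M, ∃ W ∈ l, ∀ f : C(X, ℝ), (∀ᶠ x in l, f x = 0) → (∀ x ∉ W, f x = 0) → ‖f‖ ≤ 1 →
      ‖T f‖ ≤ M := by
  by_contra! h
  obtain ⟨f, hf, hr⟩ := exists_seq_of_forall_finset_exists
    (fun f : C(X, ℝ) => (∀ᶠ x in l, f x = 0) ∧ ‖f‖ ≤ 1 ∧ 1 ≤ ‖T f‖)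
    (fun f g : C(X, ℝ) => (∀ x, f x = 0 ∨ g x = 0) ∧ 4 * ‖T f‖ ≤ ‖T g‖) (by
      intro s hs
      -- The common zero set of the earlier functions lies in `l`; a function living there is
      -- disjoint from all of them. The threshold forces growth by a factor `4`, beating the `2 ^ n`
      -- bound.
      obtain ⟨g, hg1, hg2, hg3, hg4⟩ := h (1 + ∑ f ∈ s, 4 * ‖T f‖) {x | ∀ f ∈ s, f x = 0}
        ((Filter.eventually_all_finset s).2 fun f hf => (hs f hf).1)
      have h0 : 0 ≤ ∑ f ∈ s, 4 * ‖T f‖ := Finset.sum_nonneg fun f _ => by positivity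
      refine ⟨g, ⟨hg1, hg3, by linarith⟩, fun f hf => ⟨fun x => ?_, ?_⟩⟩
      · by_cases hx : x ∈ {x | ∀ f ∈ s, f x = 0}
        · exact Or.inl (hx f hf)
        · exact Or.inr (hg2 x hx)
      · have := Finset.single_le_sum (f := fun f => 4 * ‖T f‖) (fun f _ => by positivity) hf
        linarith)
  obtain ⟨C, hC⟩ := hT.exists_norm_le_two_pow (fun n => (hf n).2.1) (by
    intro m n hmn x
    rcases hmn.lt_or_gt with h | h
    · exact (hr m n h).1 x
    · exact ((hr n m h).1 x).symm)
  have hgrow : ∀ n, (4 : ℝ) ^ n ≤ ‖T (f n)‖ := by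
    intro n
    induction n with
    | zero => simpa using (hf 0).2.2
    | succ n ih =>
      rw [pow_succ']
      exact (mul_le_mul_of_nonneg_left ih (by norm_num)).trans (hr n (n + 1) n.lt_succ_self).2
  obtain ⟨n, hn⟩ := pow_unbounded_of_one_lt C (one_lt_two : (1 : ℝ) < 2)
  have h1 := (hgrow n).trans (hC n)
  rw [show (4 : ℝ) = 2 * 2 by norm_num, mul_pow] at h1
  exact absurd (le_of_mul_le_mul_left h1 (by positivity)) (not_le.2 hn)

theorem IsDisjointnessPreserving.finite_singularitySet [T2Space X] {T : C(X, ℝ) →ₗ[ℝ] F}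
    (hT : IsDisjointnessPreserving T) : (singularitySet T).Finite := by
  by_contra hinf
  obtain ⟨z, hz⟩ := Set.Infinite.exists_accPt_principal hinf
  obtain ⟨M, W, hW, hM⟩ := hT.exists_bound_of_filter (𝓝 z)
  obtain ⟨W', hW'W, hW', hzW'⟩ := mem_nhds_iff.1 hW
  obtain ⟨x, ⟨hxW, hx⟩, hxz⟩ := (accPt_iff_nhds.1 hz) W' (hW'.mem_nhds hzW')
  -- Functions supported near the singularity `x` and away from `z` vanish near `z`, yet `T` is
  -- unbounded on them.
  obtain ⟨A, B, hA, hB, hxA, hzB, hAB⟩ := t2_separation hxz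
  have hsing := hx (W' ∩ A) (hW'.inter hA) ⟨hxW, hxA⟩
  rw [continuous_restrict_idealK_iff] at hsing
  obtain ⟨f, hf, hf1, hf2⟩ := exists_norm_le_one_lt_of_forall_not_bound T
    ((idealK (W' ∩ A)).restrictScalars ℝ) hsing M
  refine absurd (hM f ?_ ?_ hf1) (not_le.2 hf2)
  · filter_upwards [hB.mem_nhds hzB] with y hy
    exact hf y fun h => Set.disjoint_left.1 hAB h.2 hy
  · exact fun y hy => hf y fun h => hy (hW'W h.1)

/-- A disjointness preserving operator is bounded on the functions vanishing near its
singularities. -/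
theorem IsDisjointnessPreserving.exists_bound_of_vanish_near [T2Space X] {T : C(X, ℝ) →ₗ[ℝ] F}
    (hT : IsDisjointnessPreserving T) :
    ∃ C, ∀ f : C(X, ℝ), (∀ x ∈ singularitySet T, ∀ᶠ y in 𝓝 x, f y = 0) → ‖T f‖ ≤ C * ‖f‖ := by
  let A : Submodule ℝ C(X, ℝ) :=
    { carrier := {f | ∀ x ∈ singularitySet T, ∀ᶠ y in 𝓝 x, f y = 0}
      zero_mem' := fun _ _ => Filter.Eventually.of_forall fun _ => rfl
      add_mem' := fun {f g} hf hg x hx => by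
        filter_upwards [hf x hx, hg x hx] with y h1 h2
        simp [h1, h2]
      smul_mem' := fun c f hf x hx => by
        filter_upwards [hf x hx] with y h1
        simp [h1] }
  have key : ∃ C, ∀ f ∈ A, ‖T f‖ ≤ C * ‖f‖ := by
    by_contra hA
    obtain ⟨M, W, hW, hM⟩ := hT.exists_bound_of_filter (𝓝ˢ (singularitySet T))
    obtain ⟨W', hW', hSW', hW'W⟩ := mem_nhdsSet_iff_exists.1 hW
    obtain ⟨u, hu1, hu2, hu3⟩ := exists_bump_nhdsSet hT.finite_singularitySet.isClosed hW' hSW'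
    obtain ⟨V, hV, hSV, hVu⟩ := mem_nhdsSet_iff_exists.1 hu1
    obtain ⟨C, hC⟩ := exists_bound_of_disjoint_singularitySet T hV.isClosed_compl
      fun x hx hxS => hx (hSV hxS)
    -- Split `f` as `u * f`, handled by the hump bound `M`, plus a remainder of norm at most `2`
    -- living off `V`, handled by `C`.
    obtain ⟨f, hf, hf1, hf2⟩ := exists_norm_le_one_lt_of_forall_not_bound T A hA (M + |C| * 2)
    have huf : ‖u * f‖ ≤ 1 := by
      refine (ContinuousMap.norm_le _ zero_le_one).2 fun x => ?_
      rw [ContinuousMap.mul_apply, norm_mul]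
      exact mul_le_one₀ (hu2 x) (norm_nonneg _) ((f.norm_coe_le_norm x).trans hf1)
    have h1 : ‖T (u * f)‖ ≤ M := by
      refine hM _ ?_ (fun x hx => ?_) huf
      · refine eventually_nhdsSet_iff_forall.2 fun x hx => ?_
        filter_upwards [hf x hx] with y hy
        simp [hy]
      · rw [ContinuousMap.mul_apply,
          image_eq_zero_of_notMem_tsupport fun h => hx (hW'W (hu3 h)), zero_mul]
    have h2 : ‖T (f - u * f)‖ ≤ |C| * 2 := by
      calc ‖T (f - u * f)‖ ≤ C * ‖f - u * f‖ := hC _ fun x hx => by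
            have : u x = 1 := hVu (not_not.1 hx)
            simp [this]
        _ ≤ |C| * (1 + 1) := by
            gcongr
            · exact le_abs_self _
            · exact (norm_sub_le _ _).trans (add_le_add hf1 huf)
        _ = |C| * 2 := by norm_num
    have h3 : ‖T f‖ ≤ ‖T (u * f)‖ + ‖T (f - u * f)‖ := by
      calc ‖T f‖ = ‖T (u * f) + T (f - u * f)‖ := by rw [← map_add, add_sub_cancel]
        _ ≤ _ := norm_add_le _ _
    linarith
  exact key

end Lattice

end Operators

/-! ### Splitting off the continuous part -/

section Decomposition

variable {X : Type*} [TopologicalSpace X]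
  {F : Type*} [NormedAddCommGroup F] [NormedSpace ℝ F]
  [Lattice F] [IsOrderedAddMonoid F] [HasSolidNorm F]

/-- The continuous functions that are constant near each point of a set. -/
def locallyConstAt (P : Set X) : Submodule ℝ C(X, ℝ) where
  carrier := {f | ∀ x ∈ P, ∀ᶠ y in 𝓝 x, f y = f x}
  zero_mem' := fun _ _ => Filter.Eventually.of_forall fun _ => rfl
  add_mem' := fun {f g} hf hg x hx => by
    filter_upwards [hf x hx, hg x hx] with y h1 h2
    simp [h1, h2]
  smul_mem' := fun c f hf x hx => by
    filter_upwards [hf x hx] with y h1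
    simp [h1]

theorem mem_locallyConstAt_of_eventually_eq_zero {P : Set X} {f : C(X, ℝ)}
    (h : ∀ x ∈ P, ∀ᶠ y in 𝓝 x, f y = 0) : f ∈ locallyConstAt P := fun x hx => by
  filter_upwards [h x hx] with y hy
  rw [hy, (h x hx).self_of_nhds]

variable [CompactSpace X] [T2Space X]

theorem IsDisjointnessPreserving.exists_bound_locallyConstAt {T : C(X, ℝ) →ₗ[ℝ] F}
    (hT : IsDisjointnessPreserving T) :
    ∃ C, ∀ f ∈ locallyConstAt (singularitySet T), ‖T f‖ ≤ C * ‖f‖ := by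
  obtain ⟨C, hC⟩ := hT.exists_bound_of_vanish_near
  let P : Finset X := hT.finite_singularitySet.toFinset
  obtain ⟨e, he1, he2⟩ := exists_dual_bumps P
  have hP : ∀ {x}, x ∈ singularitySet T → x ∈ P := fun hx =>
    hT.finite_singularitySet.mem_toFinset.2 hx
  refine ⟨|C| * (1 + ∑ x ∈ P, ‖e x‖) + ∑ x ∈ P, ‖T (e x)‖, fun f hf => ?_⟩
  -- Subtracting the local constants leaves a function that vanishes near every singularity.
  have h1 : ‖T (f - ∑ x ∈ P, f x • e x)‖ ≤ C * ‖f - ∑ x ∈ P, f x • e x‖ := by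
    refine hC _ fun p hp => ?_
    have h2 : ∀ᶠ y in 𝓝 p, ∀ x ∈ P, p ≠ x → e x y = 0 :=
      (Filter.eventually_all_finset P).2 fun x _ =>
        Filter.eventually_imp_distrib_left.2 fun h => he2 x p (hP hp) h
    filter_upwards [hf p hp, he1 p, h2] with y hy1 hy2 hy3
    rw [ContinuousMap.sub_apply, ContinuousMap.sum_apply, Finset.sum_eq_single_of_mem p (hP hp)]
    · simp [hy1, hy2]
    · intro x hx hxp
      simp [hy3 x hx hxp.symm]
  have h3 : ‖∑ x ∈ P, f x • e x‖ ≤ (∑ x ∈ P, ‖e x‖) * ‖f‖ := by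
    rw [Finset.sum_mul]
    refine norm_sum_le_of_le _ fun x _ => ?_
    rw [norm_smul, mul_comm]
    gcongr
    exact f.norm_coe_le_norm x
  have h4 : ‖∑ x ∈ P, f x • T (e x)‖ ≤ (∑ x ∈ P, ‖T (e x)‖) * ‖f‖ := by
    rw [Finset.sum_mul]
    refine norm_sum_le_of_le _ fun x _ => ?_
    rw [norm_smul, mul_comm]
    gcongr
    exact f.norm_coe_le_norm x
  calc ‖T f‖ = ‖T (f - ∑ x ∈ P, f x • e x) + ∑ x ∈ P, f x • T (e x)‖ := by
        simp only [← map_smul, ← map_sum, ← map_add, sub_add_cancel]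
    _ ≤ |C| * (‖f‖ + (∑ x ∈ P, ‖e x‖) * ‖f‖) + (∑ x ∈ P, ‖T (e x)‖) * ‖f‖ := by
        refine (norm_add_le _ _).trans (add_le_add (h1.trans ?_) h4)
        gcongr
        · exact le_abs_self _
        · exact (norm_sub_le _ _).trans (by gcongr)
    _ = _ := by ring

/-- A disjointness preserving operator is the sum of a continuous one and one that vanishes on the
functions constant near each singularity, and both summands preserve disjointness. -/
theorem IsDisjointnessPreserving.exists_continuous_part [CompleteSpace F] {T : C(X, ℝ) →ₗ[ℝ] F}
    (hT : IsDisjointnessPreserving T) :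
    ∃ R : C(X, ℝ) →L[ℝ] F, IsDisjointnessPreserving R.toLinearMap ∧
      IsDisjointnessPreserving (T - R.toLinearMap) ∧
      ∀ f ∈ locallyConstAt (singularitySet T), R f = T f := by
  set A := locallyConstAt (singularitySet T) with hA
  have happ : ∀ f : C(X, ℝ), ∃ u : ℕ → C(X, ℝ), (∀ n, u n ∈ A) ∧
      (∀ n y, f y = 0 → u n y = 0) ∧ Filter.Tendsto u Filter.atTop (𝓝 f) := by
    intro f
    choose u hu1 hu2 hu3 using fun n : ℕ => exists_approx_locallyConst
      hT.finite_singularitySet.toFinset f (Nat.one_div_pos_of_nat (α := ℝ) (n := n))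
    refine ⟨u, fun n x hx => hu3 n x (hT.finite_singularitySet.mem_toFinset.2 hx), hu2, ?_⟩
    refine tendsto_iff_norm_sub_tendsto_zero.2 (squeeze_zero (fun _ => norm_nonneg _)
      (fun n => ?_) tendsto_one_div_add_atTop_nhds_zero_nat)
    rw [norm_sub_rev]
    exact hu1 n
  have hdense : DenseRange A.subtype := fun f => by
    obtain ⟨u, hu, -, hlim⟩ := happ f
    exact mem_closure_of_tendsto hlim (Filter.Eventually.of_forall fun n => ⟨⟨u n, hu n⟩, rfl⟩)
  obtain ⟨C, hC⟩ := hT.exists_bound_locallyConstAt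
  let R : C(X, ℝ) →L[ℝ] F := (T ∘ₗ A.subtype).extendOfNorm A.subtype
  have hR : ∀ f ∈ A, R f = T f := fun f hf =>
    LinearMap.extendOfNorm_eq hdense ⟨C, fun g => hC g g.2⟩ ⟨f, hf⟩
  have hclosed : IsClosed {p : F × F | |p.1| ⊓ |p.2| = 0} := by
    refine isClosed_eq ?_ continuous_const
    simp only [abs]
    fun_prop
  have hlimR : ∀ {f : C(X, ℝ)} {u : ℕ → C(X, ℝ)}, (∀ n, u n ∈ A) →
      Filter.Tendsto u Filter.atTop (𝓝 f) →
      Filter.Tendsto (fun n => T (u n)) Filter.atTop (𝓝 (R f)) := by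
    intro f u hu hlim
    exact ((R.continuous.tendsto f).comp hlim).congr fun n => hR _ (hu n)
  refine ⟨R, fun f g hfg => ?_, fun f g hfg => ?_, hR⟩
  all_goals
    rw [ContinuousMap.abs_inf_abs_eq_zero_iff] at hfg
    obtain ⟨u, hu, hu0, hul⟩ := happ f
    obtain ⟨v, hv, hv0, hvl⟩ := happ g
  · exact hclosed.mem_of_tendsto ((hlimR hu hul).prodMk_nhds (hlimR hv hvl))
      (Filter.Eventually.of_forall fun n => hT _ _ (ContinuousMap.abs_inf_abs_eq_zero_iff.2
        fun x => (hfg x).imp (hu0 n x) (hv0 n x)))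
  -- `(T - R) f` is the limit of `T (f - u n)`, and `f - u n` vanishes wherever `f` does.
  · refine hclosed.mem_of_tendsto ((tendsto_const_nhds.sub (hlimR hu hul)).prodMk_nhds
      (tendsto_const_nhds.sub (hlimR hv hvl))) (Filter.Eventually.of_forall fun n => ?_)
    simp only [← map_sub]
    exact hT _ _ (ContinuousMap.abs_inf_abs_eq_zero_iff.2 fun x => (hfg x).imp
      (fun h => by simp [h, hu0 n x h]) (fun h => by simp [h, hv0 n x h]))

end Decomposition

theorem mainTheorem6 {X : Type*} [TopologicalSpace X] [CompactSpace X] [T2Space X]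
    {F : Type*} [NormedAddCommGroup F] [NormedSpace ℝ F] [CompleteSpace F]
    [Lattice F] [IsOrderedAddMonoid F] [IsOrderedModule ℝ F] [HasSolidNorm F]
    (T : C(X, ℝ) →ₗ[ℝ] F) (hT : IsDisjointnessPreserving T) :
    (singularitySet T = ∅ ↔ Continuous T) ∧
    (singularitySet T).Finite ∧
    ∀ (n : ℕ) (x : Fin n → X), Function.Injective x → Set.range x = singularitySet T →
      ∃ (R : C(X, ℝ) →ₗ[ℝ] F) (S : Fin n → (C(X, ℝ) →ₗ[ℝ] F)),
        Continuous R ∧ IsDisjointnessPreserving R ∧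
        (∀ i, IsDisjointnessPreserving (S i)) ∧
        T = R + ∑ i, S i ∧
        ∀ i, (∃ f ∈ idealM (x i), S i f ≠ 0) ∧ (∀ f ∈ idealJ (x i), S i f = 0) := by
  refine ⟨singularitySet_eq_empty_iff T, hT.finite_singularitySet, fun n x hinj hx => ?_⟩
  obtain ⟨R, hR, hTR, hA⟩ := hT.exists_continuous_part
  obtain ⟨e, he1, he2⟩ := exists_dual_bumps hT.finite_singularitySet.toFinset
  have hmem : ∀ i, x i ∈ singularitySet T := fun i => hx ▸ Set.mem_range_self i
  have he3 : ∀ i j, i ≠ j → ∀ᶠ y in 𝓝 (x j), e (x i) y = 0 := fun i j hij =>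
    he2 _ _ (hT.finite_singularitySet.mem_toFinset.2 (hmem j)) (hinj.ne hij.symm)
  have hzero : ∀ f : C(X, ℝ), (∀ j, ∀ᶠ y in 𝓝 (x j), f y = 0) → (T - R.toLinearMap) f = 0 := by
    intro f hf
    refine sub_eq_zero.2 (hA f (mem_locallyConstAt_of_eventually_eq_zero ?_)).symm
    rw [← hx]
    rintro _ ⟨j, rfl⟩
    exact hf j
  let S : Fin n → (C(X, ℝ) →ₗ[ℝ] F) := fun i =>
    (T - R.toLinearMap) ∘ₗ LinearMap.mulLeft ℝ (e (x i))
  have hS : ∀ i f, S i f = (T - R.toLinearMap) (e (x i) * f) := fun _ _ => rfl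
  have hJ : ∀ i, ∀ f ∈ idealJ (x i), S i f = 0 := by
    rintro i f ⟨U, hU, hxU, hf⟩
    refine hzero _ fun j => ?_
    by_cases hij : i = j
    · subst hij
      filter_upwards [hU.mem_nhds hxU] with y hy
      simp [hf y hy]
    · filter_upwards [he3 i j hij] with y hy
      simp [hy]
  refine ⟨R.toLinearMap, S, R.continuous, hR, fun i f g hfg => ?_, ?_, fun i => ⟨?_, hJ i⟩⟩
  · rw [ContinuousMap.abs_inf_abs_eq_zero_iff] at hfg
    exact hTR _ _ (ContinuousMap.abs_inf_abs_eq_zero_iff.2 fun y => (hfg y).imp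
      (fun h => by simp [h]) (fun h => by simp [h]))
  · ext f
    have h : (T - R.toLinearMap) (f - ∑ i, e (x i) * f) = 0 := by
      refine hzero _ fun j => ?_
      have h2 : ∀ᶠ y in 𝓝 (x j), ∀ i, i ≠ j → e (x i) y = 0 :=
        Filter.eventually_all.2 fun i =>
          Filter.eventually_imp_distrib_left.2 fun h => he3 i j h
      filter_upwards [he1 (x j), h2] with y hy1 hy2
      rw [ContinuousMap.sub_apply, ContinuousMap.sum_apply,
        Finset.sum_eq_single_of_mem j (Finset.mem_univ j)]
      · simp [hy1]
      · intro i _ hij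
        simp [hy2 i hij]
    rw [map_sub, map_sum, sub_eq_zero, LinearMap.sub_apply, sub_eq_iff_eq_add'] at h
    simpa [S] using h
  -- If `S i` kills `idealM (x i)`, then `S i f = f (x i) • S i 1`. On `idealK U`, where `e (x i)`
  -- acts as the identity, this gives `T f = R f + f (x i) • S i 1`, which is bounded.
  · by_contra! hM
    obtain ⟨U, hUe, hU, hxU⟩ := mem_nhds_iff.1 (he1 (x i))
    refine hmem i U hU hxU ((continuous_restrict_idealK_iff T U).2
      ⟨‖R‖ + ‖S i 1‖, fun f hf => ?_⟩)
    have h1 : S i (f - f (x i) • 1) = 0 := hM _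
      (show (f - f (x i) • 1 : C(X, ℝ)) (x i) = 0 by simp)
    have h2 : (T - R.toLinearMap) (f - e (x i) * f) = 0 := by
      refine hzero _ fun j => ?_
      by_cases hij : i = j
      · subst hij
        filter_upwards [he1 (x i)] with y hy
        simp [hy]
      · filter_upwards [he3 i j hij] with y hy
        have hyU : y ∉ U := fun h => by
          have : e (x i) y = 1 := hUe h
          linarith
        simp [hf y hyU]
    rw [map_sub, map_smul, sub_eq_zero] at h1
    rw [map_sub, ← hS, h1, LinearMap.sub_apply, sub_eq_zero, sub_eq_iff_eq_add'] at h2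
    rw [h2, add_mul]
    refine (norm_add_le _ _).trans (add_le_add (R.le_opNorm f) ?_)
    rw [norm_smul, mul_comm]
    gcongr
    exact f.norm_coe_le_norm _
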